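/- Let $d\ge 1$, $k\ge 0$ and $n=dk+1$. A noncrossing partition $\pi$ of $[n]=\{1,\dots,n\}$ is $d$-indivisible if all blocks of $\pi$ and of its Kreweras dual have cardinality congruent to $1$ modulo $d$; let $\mathrm{NC}^d_n$ be the set of these partitions, ordered by refinement. For a cover relation $\pi\prec\sigma$ in $\mathrm{NC}^d_n$, let $B_1,B_2,\dots$ be the blocks of $\pi$ that are joined to form a block of $\sigma$, ordered so that $\min B_1<\min B_2<\cdots$, and put $\lambda(\pi,\sigma)=\max\{i\in B_1: i<\min B_2\}$. For a maximal chain $\mathbf m=\{\widehat 0=\pi_0\prec\pi_1\prec\cdots\prec\pi_k=\widehat 1\}$ put $\lambda(\mathbf m)=(\lambda(\pi_0,\pi_1),\dots,\lambda(\pi_{k-1},\pi_k))$. A $d$-parking tree is a rooted plane tree on $n=dk+1$ vertices in which the number of children of each vertex is a multiple of $d$, with a labeling of the vertices such that: the root is labeled $\infty$; every other vertex has a label $i_j$ with $1\le i\le k$, $1\le j\le d$, and no label is used twice; for each $i$ the vertices labeled $i_1,\dots,i_d$ are consecutive, in this left-to-right order, among the children of a common parent $p_i$; and if siblings are labeled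 $i_j$ and $i'_{j'}$ with $i<i'$, then $i_j$ is to the right of $i'_{j'}$. Let $\omega$ be the depth-first search (preorder, children from left to right) numbering of the vertices by $1,\dots,n$, and let $\vec a(T)=(\omega(p_1),\dots,\omega(p_k))$. Theorem. Let $\mathbf m=\{\widehat 0=\pi_0\prec\pi_1\prec\cdots\prec\pi_k=\widehat 1\}$ be a maximal chain in $\mathrm{NC}^d_{dk+1}$ and let $T$ be the $d$-parking tree such that $\lambda(\mathbf m)=\vec a(T)$. Then, for $0\le i\le k$, the blocks of $\pi_i$ are the images under $\omega$ of the vertex sets of the connected components of the graph on the vertices of $T$ whose edges are the edges of $T$ that connect a vertex $j_s$ to its parent for some $1\le j\le i$ and $1\le s\le d$. In particular, for $1\le i\le k$, the elements $\omega(p_i),\omega(i_1),\dots,\omega(i_d)$ lie in $d+1$ different blocks of $\pi_{i-1}$, and $\pi_i$ is obtained from $\pi_{i-1}$ by joining these $d+1$ blocks into one. -/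

import Mathlib

/-! ## The poset of `d`-indivisible noncrossing partitions -/

section NoncrossingPartitions

variable {n : ℕ}

/-- Partitions of `[n] = {1, …, n}` are elements of `Finpartition (Finset.Icc 1 n)`, ordered by
refinement. A partition is noncrossing if no two different blocks `B`, `C` admit
`i < j < k < l` with `i, k ∈ B` and `j, l ∈ C`. -/
def IsNoncrossing (π : Finpartition (Finset.Icc 1 n)) : Prop :=
  ∀ B ∈ π.parts, ∀ C ∈ π.parts, B ≠ C →
    ¬ ∃ i j k l : ℕ, i < j ∧ j < k ∧ k < l ∧ i ∈ B ∧ k ∈ B ∧ j ∈ C ∧ l ∈ C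

/-- The relation "`i'` and `j'` lie in the same region", where the points are placed on a circle in
the cyclic order `1 < 1' < 2 < 2' < ⋯ < n < n' < 1` and the regions are the components of
the complement of the convex hulls of the blocks. For `i ≤ j` the chord from `i'` to `j'` separates
the points of `(i, j]` from the remaining points, so the relation says that no block has points on
both sides of that chord. -/
def krewerasSetoid (π : Finpartition (Finset.Icc 1 n)) : Setoid ℕ where
  r i j := ∀ B ∈ π.parts, ∀ a ∈ B, ∀ b ∈ B,
    (a ∈ Finset.Ioc (min i j) (max i j) ↔ b ∈ Finset.Ioc (min i j) (max i j))
  iseqv :=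
    { refl := by
        intro i B _ a _ b _
        simp
      symm := by
        intro i j h B hB a ha b hb
        rw [min_comm, max_comm]
        exact h B hB a ha b hb
      trans := by
        intro i j k h₁ h₂ B hB a ha b hb
        have h₁' := h₁ B hB a ha b hb
        have h₂' := h₂ B hB a ha b hb
        simp only [Finset.mem_Ioc] at h₁' h₂' ⊢
        omega }

open Classical in
/-- The Kreweras dual of a noncrossing partition; the number `i` stands for the point `i'`. -/
noncomputable def krewerasDual (π : Finpartition (Finset.Icc 1 n)) :
    Finpartition (Finset.Icc 1 n) :=
  Finpartition.ofSetSetoid (krewerasSetoid π) (Finset.Icc 1 n)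

/-- `π` is a `d`-indivisible noncrossing partition. -/
def IsIndivisible (d : ℕ) (π : Finpartition (Finset.Icc 1 n)) : Prop :=
  IsNoncrossing π ∧ (∀ B ∈ π.parts, B.card ≡ 1 [MOD d]) ∧
    (∀ B ∈ (krewerasDual π).parts, B.card ≡ 1 [MOD d])

end NoncrossingPartitions

/-- The poset `NC^d_n`, ordered by refinement. -/
abbrev IndivisibleNC (d n : ℕ) : Type :=
  {π : Finpartition (Finset.Icc 1 n) // IsIndivisible d π}

/-- The label `λ(π, σ)` of a cover relation `π ⋖ σ`. The blocks `B₁, B₂, …` of `π` that are joined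
are those that are not blocks of `σ`; with `min B₁ < min B₂ < ⋯` the label is the largest
`i ∈ B₁` with `i < min B₂`. An element `i` of a joined block `B` that is smaller than all elements
of the other joined blocks exists only for `B = B₁`, and then the condition says `i < min B₂`. -/
noncomputable def edgeLabel {n : ℕ} (π σ : Finpartition (Finset.Icc 1 n)) : ℕ :=
  sSup {i : ℕ | ∃ B ∈ π.parts \ σ.parts, i ∈ B ∧
    ∀ C ∈ π.parts \ σ.parts, C ≠ B → ∀ x ∈ C, i < x}

/-- A maximal chain `0̂ = π₀ ⋖ π₁ ⋖ ⋯ ⋖ π_k = 1̂` of `NC^d_{dk+1}`. -/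
structure MaximalChainNC (d k : ℕ) where
  elem : Fin (k + 1) → IndivisibleNC d (d * k + 1)
  isBot : IsBot (elem 0)
  isTop : IsTop (elem (Fin.last k))
  covBy : ∀ i : Fin k, elem i.castSucc ⋖ elem i.succ

/-- The list of labels `λ(m)`; its entry with (zero-based) index `i` is the label of the step from
`elem i` to `elem (i + 1)`. -/
noncomputable def MaximalChainNC.labels {d k : ℕ} (m : MaximalChainNC d k) (i : Fin k) : ℕ :=
  edgeLabel (m.elem i.castSucc).1 (m.elem i.succ).1

/-! ## Plane trees and the depth-first search ordering -/

/-- A rooted plane tree with vertex set `V`: `children v` lists the children of `v` from left to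
right. By well-foundedness, moving from vertices to their parents always ends, at the root. -/
structure PlaneTree (V : Type*) where
  root : V
  parent : V → Option V
  children : V → List V
  parent_eq_none_iff : ∀ v, parent v = none ↔ v = root
  mem_children_iff : ∀ u v, v ∈ children u ↔ parent v = some u
  nodup_children : ∀ v, (children v).Nodup
  wf : WellFounded fun u v => parent v = some u

namespace PlaneTree

variable {V : Type*} (T : PlaneTree V)

/-- The vertex set of `T(u)`, that is, the set of all descendants of `u`, including `u`. -/
def subtree (u : V) : Set V :=
  {v | Relation.ReflTransGen (fun x y => T.parent y = some x) u v}

open Classical in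
/-- The depth-first search ordering of `T` starting with the number `a`: the root gets the number
`a`, and if `r₁, …, r_s` are the children of `u` in the left-to-right order, then the number of
`r_i` is the number of `u` plus `|T(r₁)| + ⋯ + |T(r_{i-1})| + 1`. -/
noncomputable def depthFirst (a : ℕ) : V → ℕ :=
  T.wf.fix fun v ih =>
    match h : T.parent v with
    | none => a
    | some u => ih u h +
        (((T.children u).takeWhile fun w => w ≠ v).map fun w => (T.subtree w).ncard).sum + 1

theorem depthFirst_root (a : ℕ) : T.depthFirst a T.root = a := by
  have h := (T.parent_eq_none_iff T.root).2 rfl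
  rw [depthFirst, WellFounded.fix_eq]
  split
  · rfl
  · simp_all

open Classical in
theorem depthFirst_of_parent (a : ℕ) {u v : V} (h : T.parent v = some u) :
    T.depthFirst a v = T.depthFirst a u +
      (((T.children u).takeWhile fun w => w ≠ v).map fun w => (T.subtree w).ncard).sum + 1 := by
  rw [depthFirst, WellFounded.fix_eq]
  split
  · simp_all
  · rename_i u' h'
    obtain rfl : u = u' := by simpa [h] using h'
    rfl

end PlaneTree

/-! ## Parking trees -/

/-- A `d`-parking tree on `n = dk + 1` vertices. The label `∞` is `⊤`, and the label `i_j` is the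
pair `(i, j)`, with `i` and `j` counted from zero. -/
structure ParkingTree (d k : ℕ) (V : Type*) extends PlaneTree V where
  label : V → WithTop (Fin k × Fin d)
  card_vertices : Nat.card V = d * k + 1
  dvd_children : ∀ v, d ∣ (children v).length
  label_root : label root = ⊤
  label_of_ne_root : ∀ v, v ≠ root → ∃ i j, label v = ((i, j) : Fin k × Fin d)
  /-- For each `i`, the labels `i_1, …, i_d` are consecutive in the left-to-right order of the
  children of some vertex. -/
  consecutive : ∀ i : Fin k, ∃ p,
    List.ofFn (fun j : Fin d => (((i, j) : Fin k × Fin d) : WithTop (Fin k × Fin d))) <:+: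
      (children p).map label
  /-- No label is used twice. -/
  label_injective : Function.Injective label
  /-- If `u` is to the left of its sibling `v`, then the label `i_j` of `u` and the label `i'_{j'}`
  of `v` satisfy `i' ≤ i`. -/
  decreasing : ∀ p, (children p).Pairwise fun u v =>
    ∀ i j i' j', label u = ((i, j) : Fin k × Fin d) → label v = ((i', j') : Fin k × Fin d) →
      i' ≤ i

namespace ParkingTree

variable {d k : ℕ} {V : Type*} (T : ParkingTree d k V)

/-- The common parent `p_i` of the vertices `i_1, …, i_d`. -/
noncomputable def commonParent (i : Fin k) : V := (T.consecutive i).choose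

theorem exists_vertex (i : Fin k) (j : Fin d) :
    ∃ v ∈ T.children (T.commonParent i), T.label v = ((i, j) : Fin k × Fin d) := by
  have h := (T.consecutive i).choose_spec.subset
    (List.mem_ofFn.2 ⟨j, rfl⟩ : (((i, j) : Fin k × Fin d) : WithTop (Fin k × Fin d)) ∈ _)
  exact List.mem_map.1 h

/-- The vertex labeled `i_j`. -/
noncomputable def vertex (i : Fin k) (j : Fin d) : V := (T.exists_vertex i j).choose

theorem label_vertex (i : Fin k) (j : Fin d) :
    T.label (T.vertex i j) = ((i, j) : Fin k × Fin d) :=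
  (T.exists_vertex i j).choose_spec.2

theorem parent_vertex (i : Fin k) (j : Fin d) :
    T.parent (T.vertex i j) = some (T.commonParent i) :=
  (T.mem_children_iff _ _).1 (T.exists_vertex i j).choose_spec.1

/-- The depth-first search ordering `ω` of the vertices, using the interval `[1, n]`. -/
noncomputable def order : V → ℕ := T.depthFirst 1

/-- The `d`-parking function `a(T) = (a₁, …, a_k)`, where `a_i = ω(p_i)`. -/
noncomputable def parkingFunction (i : Fin k) : ℕ := T.order (T.commonParent i)

/-- The graph on the vertices of `T` containing the edges that connect one of the vertices `j_s`
with `1 ≤ j ≤ i` (that is, with zero-based index `j` less than `i`) to its parent. -/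
def stepGraph (i : ℕ) : SimpleGraph V :=
  SimpleGraph.fromRel fun u v =>
    ∃ (j : Fin k) (s : Fin d), (j : ℕ) < i ∧ v = T.vertex j s ∧ T.parent v = some u

/-- The elements `ω(p_i), ω(i_1), …, ω(i_d)`. -/
noncomputable def stepElements (i : Fin k) : Finset ℕ :=
  insert (T.order (T.commonParent i)) (Finset.univ.image fun j : Fin d => T.order (T.vertex i j))

end ParkingTree

/-- The blocks of `π` that contain an element of `S`. -/
def blocksMeeting {n : ℕ} (π : Finpartition (Finset.Icc 1 n)) (S : Finset ℕ) :
    Finset (Finset ℕ) :=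
  π.parts.filter fun B => ∃ x ∈ S, x ∈ B

/-! For each step of the chain, collect the minima of the joined blocks except the smallest one
(`joinedMinima`). It suffices to show that the `i`-th such set is `{ω(i_1), …, ω(i_d)}`
(`childSet`): the step then joins the blocks of `ω(p_i), ω(i_1), …, ω(i_d)`, and induction along the
chain turns blocks into components.

Both families consist of disjoint `d`-sets covering `{2, …, n}`. Draw arcs from the `i`-th label to
the elements of the `i`-th set. In both families the arcs go to the right and do not cross, and sets
with equal labels occur from left to right in decreasing order of index. By
`mem_iff_mem_of_noncrossing_arcs` these properties determine the family from the labels. For the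
tree they come from the nested intervals of depth-first search.

For the chain they come from counting. Block sizes modulo `d` make each of the `k` steps lose at
least `d` blocks and gain at least `d` dual blocks; there is no room for more, so each step joins
exactly `d + 1` blocks and splits a single block of the dual. That one dual block yields the
conditions `gap` and `not_nested` of `IsMerge`, from which noncrossing arcs follow. -/

theorem List.Pairwise.rel_or_rel {α : Type*} {R : α → α → Prop} {l : List α} (h : l.Pairwise R)
    {a b : α} (ha : a ∈ l) (hb : b ∈ l) (hab : a ≠ b) : R a b ∨ R b a := by
  have : Std.Symm fun a b => R a b ∨ R b a := ⟨fun _ _ => Or.symm⟩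
  exact (h.imp (S := fun a b => R a b ∨ R b a) Or.inl).forall ha hb hab

/-! ### Depth-first search intervals of subtrees. -/

namespace PlaneTree

variable {V : Type*} (T : PlaneTree V)

theorem mem_subtree_self (u : V) : u ∈ T.subtree u := Relation.ReflTransGen.refl

theorem subtree_subset {u v : V} (h : v ∈ T.subtree u) : T.subtree v ⊆ T.subtree u :=
  fun _ hw => Relation.ReflTransGen.trans h hw

theorem mem_subtree_of_parent {u v : V} (h : T.parent v = some u) : v ∈ T.subtree u :=
  Relation.ReflTransGen.single h

theorem mem_subtree_iff {u v : V} :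
    v ∈ T.subtree u ↔ v = u ∨ ∃ w, T.parent w = some u ∧ v ∈ T.subtree w := by
  constructor
  · intro h
    rcases Relation.ReflTransGen.cases_head h with h | ⟨w, hw, hv⟩
    · exact Or.inl h.symm
    · exact Or.inr ⟨w, hw, hv⟩
  · rintro (rfl | ⟨w, hw, hv⟩)
    · exact T.mem_subtree_self _
    · exact T.subtree_subset (T.mem_subtree_of_parent hw) hv

theorem notMem_subtree_of_parent {u w : V} (h : T.parent w = some u) : u ∉ T.subtree w := by
  intro hu
  have h1 : Relation.TransGen (fun x y => T.parent y = some x) u u :=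
    Relation.TransGen.head' h hu
  exact T.wf.transGen.irrefl.irrefl u h1

theorem eq_of_mem_subtree_of_mem_subtree {u w w' v : V} (hw : T.parent w = some u)
    (hw' : T.parent w' = some u) (hv : v ∈ T.subtree w) (hv' : v ∈ T.subtree w') : w = w' := by
  have key : ∀ {x y : V}, T.parent x = some u → T.parent y = some u → x ∈ T.subtree y →
      x = y := by
    intro x y hx hy hxy
    rcases Relation.ReflTransGen.cases_tail hxy with h | ⟨z, hz, hzx⟩
    · exact h
    · obtain rfl : u = z := by simpa [hx] using hzx
      exact absurd hz (T.notMem_subtree_of_parent hy)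
  -- Parents are unique, so the ancestors of `v` form a chain, and `w`, `w'` are comparable in it.
  have hru : Relator.RightUnique (Function.swap fun x y => T.parent y = some x) := by
    intro a b c hb hc
    simp only [Function.swap] at hb hc
    simpa [hb] using hc
  have h1 := Relation.reflTransGen_swap.2 hv
  have h2 := Relation.reflTransGen_swap.2 hv'
  rcases Relation.ReflTransGen.total_of_right_unique hru h1 h2 with h | h
  · exact key hw hw' (Relation.reflTransGen_swap.1 h)
  · exact (key hw' hw (Relation.reflTransGen_swap.1 h)).symm

theorem sum_ncard_subtree [Finite V] {u : V} (l : List V) (hl : l.Nodup)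
    (hp : ∀ w ∈ l, T.parent w = some u) :
    (l.map fun w => (T.subtree w).ncard).sum = {v | ∃ w ∈ l, v ∈ T.subtree w}.ncard := by
  induction l with
  | nil => simp
  | cons a l ih =>
    rw [List.nodup_cons] at hl
    have hset : {v | ∃ w ∈ a :: l, v ∈ T.subtree w} =
        T.subtree a ∪ {v | ∃ w ∈ l, v ∈ T.subtree w} := by
      ext v; simp
    rw [hset, Set.ncard_union_eq, List.map_cons, List.sum_cons,
      ih hl.2 fun w hw => hp w (List.mem_cons_of_mem _ hw)]
    rw [Set.disjoint_left]
    rintro v hv ⟨w, hw, hvw⟩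
    exact hl.1 (T.eq_of_mem_subtree_of_mem_subtree (hp a List.mem_cons_self)
      (hp w (List.mem_cons_of_mem _ hw)) hv hvw ▸ hw)

theorem ncard_subtree [Finite V] (u : V) :
    (T.subtree u).ncard = ((T.children u).map fun w => (T.subtree w).ncard).sum + 1 := by
  rw [T.sum_ncard_subtree (T.children u) (T.nodup_children u)
    fun w hw => (T.mem_children_iff u w).1 hw, ← Set.ncard_insert_of_notMem]
  · congr 1
    ext v
    simp only [Set.mem_insert_iff, Set.mem_ofPred_eq, T.mem_children_iff]
    exact T.mem_subtree_iff
  · rintro ⟨w, hw, hu⟩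
    exact T.notMem_subtree_of_parent ((T.mem_children_iff u w).1 hw) hu

theorem depthFirst_of_children_eq (a : ℕ) {u v : V} {l₁ l₂ : List V}
    (h : T.children u = l₁ ++ v :: l₂) :
    T.depthFirst a v = T.depthFirst a u + (l₁.map fun w => (T.subtree w).ncard).sum + 1 := by
  classical
  have hv : T.parent v = some u := (T.mem_children_iff u v).1 (by simp [h])
  have hn := T.nodup_children u
  rw [h, List.nodup_append] at hn
  rw [T.depthFirst_of_parent a hv, h, List.takeWhile_append_of_pos]
  · simp
  · intro w hw
    simpa using hn.2.2 w hw v (by simp)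

theorem depthFirst_lt_of_parent (a : ℕ) {u v : V} (h : T.parent v = some u) :
    T.depthFirst a u < T.depthFirst a v := by
  classical
  rw [T.depthFirst_of_parent a h]
  omega

/-- Each `T(v)` gets the interval of `|T(v)|` numbers starting at the number of `v`; intervals of
children nest in that of the parent. -/
theorem depthFirst_add_ncard_le_of_parent [Finite V] (a : ℕ) {u v : V} (h : T.parent v = some u) :
    T.depthFirst a v + (T.subtree v).ncard ≤ T.depthFirst a u + (T.subtree u).ncard := by
  obtain ⟨l₁, l₂, hl⟩ := List.append_of_mem ((T.mem_children_iff u v).2 h)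
  rw [T.depthFirst_of_children_eq a hl, T.ncard_subtree u, hl]
  simp only [List.map_append, List.sum_append, List.map_cons, List.sum_cons]
  omega

theorem depthFirst_of_mem_subtree [Finite V] (a : ℕ) {u v : V} (h : v ∈ T.subtree u) :
    T.depthFirst a u ≤ T.depthFirst a v ∧
      T.depthFirst a v + (T.subtree v).ncard ≤ T.depthFirst a u + (T.subtree u).ncard := by
  induction h with
  | refl => exact ⟨le_rfl, le_rfl⟩
  | tail _ hbc ih =>
    have h1 := T.depthFirst_lt_of_parent a hbc
    have h2 := T.depthFirst_add_ncard_le_of_parent a hbc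
    omega

theorem ncard_subtree_pos [Finite V] (u : V) : 0 < (T.subtree u).ncard := by
  rw [T.ncard_subtree]; omega

theorem depthFirst_lt_of_mem_subtree [Finite V] (a : ℕ) {u v : V} (h : v ∈ T.subtree u) :
    T.depthFirst a v < T.depthFirst a u + (T.subtree u).ncard := by
  have h1 := (T.depthFirst_of_mem_subtree a h).2
  have h2 := T.ncard_subtree_pos v
  omega

theorem pairwise_children (a : ℕ) (u : V) :
    (T.children u).Pairwise fun v w =>
      T.depthFirst a v + (T.subtree v).ncard ≤ T.depthFirst a w := by
  rw [List.pairwise_iff_forall_sublist]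
  intro v w hvw
  obtain ⟨l₁, l₂, hl, h1, h2⟩ := List.cons_sublist_iff.1 hvw
  obtain ⟨m₁, m₂, rfl⟩ := List.append_of_mem h1
  obtain ⟨m₃, m₄, rfl⟩ := List.append_of_mem (List.singleton_sublist.1 h2)
  have hv := T.depthFirst_of_children_eq a (u := u) (v := v) (l₁ := m₁)
    (l₂ := m₂ ++ (m₃ ++ w :: m₄)) (by simp [hl])
  have hw := T.depthFirst_of_children_eq a (u := u) (v := w) (l₁ := m₁ ++ v :: m₂ ++ m₃)
    (l₂ := m₄) (by simp [hl])
  rw [hv, hw]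
  simp only [List.map_append, List.sum_append, List.map_cons, List.sum_cons]
  omega

theorem depthFirst_of_siblings (a : ℕ) {u v w : V} (hv : T.parent v = some u)
    (hw : T.parent w = some u) (hvw : v ≠ w) :
    T.depthFirst a v + (T.subtree v).ncard ≤ T.depthFirst a w ∨
      T.depthFirst a w + (T.subtree w).ncard ≤ T.depthFirst a v :=
  (T.pairwise_children a u).rel_or_rel ((T.mem_children_iff u v).2 hv)
    ((T.mem_children_iff u w).2 hw) hvw

theorem depthFirst_trichotomy [Finite V] (a : ℕ) {r u v : V} (hu : u ∈ T.subtree r)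
    (hv : v ∈ T.subtree r) :
    u ∈ T.subtree v ∨ v ∈ T.subtree u ∨
      T.depthFirst a u + (T.subtree u).ncard ≤ T.depthFirst a v ∨
      T.depthFirst a v + (T.subtree v).ncard ≤ T.depthFirst a u := by
  induction h : (T.subtree r).ncard using Nat.strong_induction_on generalizing r with
  | _ N ih =>
    rcases T.mem_subtree_iff.1 hu with rfl | ⟨w, hw, huw⟩
    · exact Or.inr (Or.inl hv)
    rcases T.mem_subtree_iff.1 hv with rfl | ⟨w', hw', hvw⟩
    · exact Or.inl hu
    by_cases hww : w = w'
    · subst hww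
      refine ih _ ?_ huw hvw rfl
      -- The numbering from `0` is auxiliary: its nested intervals show that `T(w)` is smaller than
      -- the subtree of its parent.
      have h1 := T.depthFirst_lt_of_parent 0 hw
      have h2 := T.depthFirst_add_ncard_le_of_parent 0 hw
      omega
    · have h1 := T.depthFirst_of_mem_subtree a huw
      have h2 := T.depthFirst_of_mem_subtree a hvw
      rcases T.depthFirst_of_siblings a hw hw' hww with h3 | h3
      · right; right; left; omega
      · right; right; right; omega

theorem mem_subtree_root (v : V) : v ∈ T.subtree T.root := by
  induction v using T.wf.induction with
  | _ v ih =>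
    cases h : T.parent v with
    | none => rw [(T.parent_eq_none_iff v).1 h]; exact T.mem_subtree_self _
    | some u => exact (ih u h).tail h

theorem subtree_root : T.subtree T.root = Set.univ :=
  Set.eq_univ_of_forall T.mem_subtree_root

theorem depthFirst_injective [Finite V] (a : ℕ) : Function.Injective (T.depthFirst a) := by
  have key : ∀ {u v : V}, v ∈ T.subtree u → T.depthFirst a u = T.depthFirst a v → u = v := by
    intro u v h he
    rcases T.mem_subtree_iff.1 h with rfl | ⟨w, hw, hv⟩
    · rfl
    · have h1 := T.depthFirst_lt_of_parent a hw
      have h2 := (T.depthFirst_of_mem_subtree a hv).1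
      omega
  intro u v huv
  have h1 := T.ncard_subtree_pos u
  have h2 := T.ncard_subtree_pos v
  rcases T.depthFirst_trichotomy a (T.mem_subtree_root u) (T.mem_subtree_root v) with h | h | h | h
  · exact (key h huv.symm).symm
  · exact key h huv
  · omega
  · omega

/-- The arcs joining the vertices to their parents do not cross in the depth-first ordering. -/
theorem depthFirst_noncrossing [Finite V] (a : ℕ) {u w x z : V} (hx : T.parent x = some u)
    (hz : T.parent z = some w) (huw : T.depthFirst a u < T.depthFirst a w)
    (hwx : T.depthFirst a w < T.depthFirst a x) : T.depthFirst a z ≤ T.depthFirst a x := by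
  have hxu := T.depthFirst_lt_of_mem_subtree a (T.mem_subtree_of_parent hx)
  rcases T.depthFirst_trichotomy a (T.mem_subtree_root u) (T.mem_subtree_root w) with h | h | h | h
  · have := (T.depthFirst_of_mem_subtree a h).1
    omega
  · rcases T.mem_subtree_iff.1 h with rfl | ⟨c, hc, hwc⟩
    · omega
    -- The child `c` of `u` above `w` precedes its sibling `x`, so all of `T(c)`, including `z`, is
    -- numbered before `x`.
    have h1 := (T.depthFirst_of_mem_subtree a hwc).1
    by_cases hcx : c = x
    · subst hcx; omega
    have h2 := T.depthFirst_lt_of_mem_subtree a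
      (T.subtree_subset hwc (T.mem_subtree_of_parent hz))
    have h3 := T.ncard_subtree_pos x
    rcases T.depthFirst_of_siblings a hc hx hcx with h4 | h4 <;> omega
  · omega
  · have := T.ncard_subtree_pos w
    omega

end PlaneTree

/-! ### The arcs of a parking tree. -/

namespace ParkingTree

variable {d k : ℕ} {V : Type*} (T : ParkingTree d k V)

theorem finite (T : ParkingTree d k V) : Finite V := Nat.finite_of_card_ne_zero (by rw [T.card_vertices]; omega)

theorem order_injective : Function.Injective T.order :=
  have := T.finite
  T.depthFirst_injective 1

theorem order_mem_Icc (v : V) : T.order v ∈ Finset.Icc 1 (d * k + 1) := by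
  have := T.finite
  have h := T.depthFirst_of_mem_subtree 1 (T.mem_subtree_root v)
  have h' := T.depthFirst_lt_of_mem_subtree 1 (T.mem_subtree_root v)
  rw [T.depthFirst_root, T.subtree_root, Set.ncard_univ, T.card_vertices] at *
  rw [Finset.mem_Icc, order]
  omega

theorem exists_order_eq {x : ℕ} (hx : x ∈ Finset.Icc 1 (d * k + 1)) : ∃ v, T.order v = x := by
  have := T.finite
  have := Fintype.ofFinite V
  classical
  have h : Finset.univ.image T.order = Finset.Icc 1 (d * k + 1) := by
    apply Finset.eq_of_subset_of_card_le
    · intro x hx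
      obtain ⟨v, -, rfl⟩ := Finset.mem_image.1 hx
      exact T.order_mem_Icc v
    · rw [Finset.card_image_of_injective _ T.order_injective, Finset.card_univ,
        ← Nat.card_eq_fintype_card, T.card_vertices]
      simp
  rw [← h] at hx
  obtain ⟨v, -, hv⟩ := Finset.mem_image.1 hx
  exact ⟨v, hv⟩

theorem vertex_injective {i i' : Fin k} {j j' : Fin d} (h : T.vertex i j = T.vertex i' j') :
    i = i' ∧ j = j' := by
  have h1 := congrArg T.label h
  rw [T.label_vertex, T.label_vertex, WithTop.coe_inj] at h1
  simpa using h1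

theorem exists_eq_vertex {v : V} (h : v ≠ T.root) : ∃ i j, v = T.vertex i j := by
  obtain ⟨i, j, hij⟩ := T.label_of_ne_root v h
  exact ⟨i, j, T.label_injective (hij.trans (T.label_vertex i j).symm)⟩

/-- The set `{ω(i_1), …, ω(i_d)}`. -/
noncomputable def childSet (i : Fin k) : Finset ℕ :=
  Finset.univ.image fun j : Fin d => T.order (T.vertex i j)

theorem mem_childSet {i : Fin k} {x : ℕ} :
    x ∈ T.childSet i ↔ ∃ j, T.order (T.vertex i j) = x := by
  simp [childSet]

theorem card_childSet (i : Fin k) : (T.childSet i).card = d := by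
  rw [childSet, Finset.card_image_of_injective, Finset.card_univ, Fintype.card_fin]
  intro j j' h
  exact (T.vertex_injective (T.order_injective h)).2

theorem childSet_disjoint {i i' : Fin k} {x : ℕ} (h : x ∈ T.childSet i) (h' : x ∈ T.childSet i') :
    i = i' := by
  obtain ⟨j, rfl⟩ := T.mem_childSet.1 h
  obtain ⟨j', hj⟩ := T.mem_childSet.1 h'
  exact (T.vertex_injective (T.order_injective hj)).1.symm

theorem exists_mem_childSet_iff {x : ℕ} :
    (∃ i, x ∈ T.childSet i) ↔ x ∈ Finset.Icc 2 (d * k + 1) := by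
  have hr : T.order T.root = 1 := T.depthFirst_root 1
  constructor
  · rintro ⟨i, hi⟩
    obtain ⟨j, rfl⟩ := T.mem_childSet.1 hi
    have h1 := Finset.mem_Icc.1 (T.order_mem_Icc (T.vertex i j))
    have h2 : T.order (T.vertex i j) ≠ 1 := by
      intro h
      have h3 := T.order_injective (h.trans hr.symm)
      have h4 := T.parent_vertex i j
      rw [h3, (T.parent_eq_none_iff _).2 rfl] at h4
      simp at h4
    rw [Finset.mem_Icc]
    omega
  · intro hx
    rw [Finset.mem_Icc] at hx
    obtain ⟨v, rfl⟩ := T.exists_order_eq (x := x) (Finset.mem_Icc.2 (by omega))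
    obtain ⟨i, j, rfl⟩ := T.exists_eq_vertex (v := v) (by rintro rfl; omega)
    exact ⟨i, T.mem_childSet.2 ⟨j, rfl⟩⟩

theorem parkingFunction_lt {i : Fin k} {x : ℕ} (h : x ∈ T.childSet i) :
    T.parkingFunction i < x := by
  obtain ⟨j, rfl⟩ := T.mem_childSet.1 h
  exact T.depthFirst_lt_of_parent 1 (T.parent_vertex i j)

theorem childSet_noncrossing {i j : Fin k} {x z : ℕ} (hx : x ∈ T.childSet i)
    (hz : z ∈ T.childSet j) (hij : T.parkingFunction i < T.parkingFunction j)
    (hjx : T.parkingFunction j < x) : z ≤ x := by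
  have := T.finite
  obtain ⟨s, rfl⟩ := T.mem_childSet.1 hx
  obtain ⟨t, rfl⟩ := T.mem_childSet.1 hz
  exact T.depthFirst_noncrossing 1 (T.parent_vertex i s) (T.parent_vertex j t) hij hjx

theorem childSet_decreasing {i j : Fin k} {x z : ℕ} (hx : x ∈ T.childSet i)
    (hz : z ∈ T.childSet j) (hij : T.parkingFunction i = T.parkingFunction j)
    (hxz : x < z) : j ≤ i := by
  obtain ⟨s, rfl⟩ := T.mem_childSet.1 hx
  obtain ⟨t, rfl⟩ := T.mem_childSet.1 hz
  have hp := T.order_injective hij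
  have h1 := T.parent_vertex i s
  have h2 := T.parent_vertex j t
  rw [← hp] at h2
  rcases ((T.pairwise_children 1 (T.commonParent i)).and
    (T.decreasing (T.commonParent i))).rel_or_rel ((T.mem_children_iff _ _).2 h1)
    ((T.mem_children_iff _ _).2 h2) (by intro h; rw [h] at hxz; omega) with h | h
  · exact h.2 i s j t (T.label_vertex _ _) (T.label_vertex _ _)
  · have h3 : T.order (T.vertex j t) ≤ T.order (T.vertex i s) := (Nat.le_add_right _ _).trans h.1
    omega

end ParkingTree

/-! ### Uniqueness of noncrossing arc families. -/

/-- A family of disjoint `d`-sets covering a set is determined by the left endpoints of the arcs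
that join its members to them, if the arcs do not cross and the sets with a common left endpoint
come in decreasing order. -/
theorem mem_iff_mem_of_noncrossing_arcs {d k : ℕ} {X : Set ℕ} {a : Fin k → ℕ}
    {S S' : Fin k → Finset ℕ}
    (hc : ∀ i, (S i).card = d) (hc' : ∀ i, (S' i).card = d)
    (hd : ∀ i j x, x ∈ S i → x ∈ S j → i = j) (hd' : ∀ i j x, x ∈ S' i → x ∈ S' j → i = j)
    (hu : ∀ x, (∃ i, x ∈ S i) ↔ x ∈ X) (hu' : ∀ x, (∃ i, x ∈ S' i) ↔ x ∈ X)
    (hlt : ∀ i, ∀ x ∈ S i, a i < x) (hlt' : ∀ i, ∀ x ∈ S' i, a i < x)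
    (hn : ∀ i j x z, x ∈ S i → z ∈ S j → a i < a j → a j < x → z ≤ x)
    (hn' : ∀ i j x z, x ∈ S' i → z ∈ S' j → a i < a j → a j < x → z ≤ x)
    (hm : ∀ i j x z, x ∈ S i → z ∈ S j → a i = a j → x < z → j ≤ i)
    (hm' : ∀ i j x z, x ∈ S' i → z ∈ S' j → a i = a j → x < z → j ≤ i)
    (x : ℕ) (i : Fin k) : x ∈ S i ↔ x ∈ S' i := by
  -- Let the families agree below `x` but place `x` in `S i` and in `S' j`. Noncrossing (or the
  -- decreasing order, if the labels agree) forces all of `S j` below `x`, so `S' j` contains `S j`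
  -- and `x`: too many elements.
  have key : ∀ {S S' : Fin k → Finset ℕ} {x : ℕ} {i j : Fin k}, (∀ i, (S i).card = d) →
      (∀ i, (S' i).card = d) → (∀ i j x, x ∈ S i → x ∈ S j → i = j) →
      (∀ i, ∀ x ∈ S' i, a i < x) →
      (∀ i j x z, x ∈ S i → z ∈ S j → a i < a j → a j < x → z ≤ x) →
      (∀ i j x z, x ∈ S i → z ∈ S j → a i = a j → x < z → j ≤ i) →
      (∀ y < x, ∀ l, y ∈ S l ↔ y ∈ S' l) → x ∈ S i → x ∈ S' j →
      (a i < a j ∨ a i = a j ∧ i < j) → False := by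
    intro S S' x i j hc hc' hd hlt hn hm ih hi hj h
    have hij : i ≠ j := by rintro rfl; omega
    have hlow : ∀ z ∈ S j, z < x := by
      intro z hz
      have hzx : z ≠ x := by rintro rfl; exact hij (hd _ _ _ hi hz)
      rcases h with h | ⟨h, h'⟩
      · have := hn i j x z hi hz h (hlt j x hj)
        omega
      · by_contra hxz
        have := hm i j x z hi hz h (by omega)
        omega
    have hsub : insert x (S j) ⊆ S' j := by
      intro z hz
      rcases Finset.mem_insert.1 hz with rfl | hz
      · exact hj
      · exact (ih z (hlow z hz) j).1 hz
    have h1 := Finset.card_le_card hsub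
    rw [Finset.card_insert_of_notMem fun h => (hlow x h).false, hc, hc'] at h1
    omega
  induction x using Nat.strong_induction_on generalizing i with
  | _ x ih =>
    have main : ∀ i j, x ∈ S i → x ∈ S' j → i = j := by
      intro i j hi hj
      by_contra hij
      rcases lt_trichotomy (a i) (a j) with h | h | h
      · exact key hc hc' hd hlt' hn hm ih hi hj (Or.inl h)
      · rcases lt_or_gt_of_ne hij with h' | h'
        · exact key hc hc' hd hlt' hn hm ih hi hj (Or.inr ⟨h, h'⟩)
        · exact key hc' hc hd' hlt hn' hm' (fun y hy l => (ih y hy l).symm) hj hi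
            (Or.inr ⟨h.symm, h'⟩)
      · exact key hc' hc hd' hlt hn' hm' (fun y hy l => (ih y hy l).symm) hj hi (Or.inl h)
    constructor
    · intro hi
      obtain ⟨j, hj⟩ := (hu' x).2 ((hu x).1 ⟨i, hi⟩)
      rwa [main i j hi hj]
    · intro hi
      obtain ⟨j, hj⟩ := (hu x).2 ((hu' x).1 ⟨i, hi⟩)
      rwa [← main j i hj hi]

/-! ### Counting blocks of size 1 modulo `d`. -/

namespace Finpartition

variable {d : ℕ} {s : Finset ℕ} {P Q : Finpartition s}

theorem subset_of_le_of_mem (h : P ≤ Q) {B C : Finset ℕ} {x : ℕ} (hC : C ∈ P.parts)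
    (hB : B ∈ Q.parts) (hxC : x ∈ C) (hxB : x ∈ B) : C ⊆ B := by
  obtain ⟨D, hD, hCD⟩ := h hC
  rwa [← Q.eq_of_mem_parts hD hB (hCD hxC) hxB]

theorem biUnion_filter_subset (h : P ≤ Q) {B : Finset ℕ} (hB : B ∈ Q.parts) :
    {C ∈ P.parts | C ⊆ B}.biUnion id = B := by
  ext x
  simp only [Finset.mem_biUnion, Finset.mem_filter, id]
  constructor
  · rintro ⟨C, ⟨-, hCB⟩, hx⟩
    exact hCB hx
  · intro hx
    obtain ⟨C, hC, hxC⟩ := P.exists_mem (Q.subset hB hx)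
    exact ⟨C, ⟨hC, subset_of_le_of_mem h hC hB hxC hx⟩, hxC⟩

theorem card_filter_subset_modEq (h : P ≤ Q) (hP : ∀ C ∈ P.parts, C.card ≡ 1 [MOD d])
    {B : Finset ℕ} (hB : B ∈ Q.parts) : {C ∈ P.parts | C ⊆ B}.card ≡ B.card [MOD d] := by
  have h1 : B.card = ∑ C ∈ P.parts with C ⊆ B, C.card := by
    conv_lhs => rw [← biUnion_filter_subset h hB]
    exact Finset.card_biUnion fun C hC D hD hCD =>
      P.disjoint (Finset.mem_filter.1 hC).1 (Finset.mem_filter.1 hD).1 hCD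
  rw [h1, Finset.card_eq_sum_ones]
  exact (Nat.ModEq.sum fun C hC => hP C (Finset.mem_filter.1 hC).1).symm

theorem sum_card_filter_subset (h : P ≤ Q) :
    ∑ B ∈ Q.parts, {C ∈ P.parts | C ⊆ B}.card = P.parts.card := by
  rw [← Finset.card_biUnion]
  · congr 1
    ext C
    simp only [Finset.mem_biUnion, Finset.mem_filter]
    constructor
    · rintro ⟨_, _, hC, _⟩
      exact hC
    · intro hC
      obtain ⟨B, hB, hCB⟩ := h hC
      exact ⟨B, hB, hC, hCB⟩
  · intro B hB D hD hBD
    rw [Function.onFun, Finset.disjoint_left]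
    intro C hC hC'
    rw [Finset.mem_filter] at hC hC'
    obtain ⟨x, hx⟩ := P.nonempty_of_mem_parts hC.1
    exact hBD (Q.eq_of_mem_parts hB hD (hC.2 hx) (hC'.2 hx))

theorem card_filter_subset_pos (h : P ≤ Q) {B : Finset ℕ} (hB : B ∈ Q.parts) :
    0 < {C ∈ P.parts | C ⊆ B}.card := by
  obtain ⟨x, hx⟩ := Q.nonempty_of_mem_parts hB
  obtain ⟨C, hC, hxC⟩ := P.exists_mem (Q.subset hB hx)
  exact Finset.card_pos.2
    ⟨C, Finset.mem_filter.2 ⟨hC, subset_of_le_of_mem h hC hB hxC hx⟩⟩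

/-- The number of pieces is congruent to `|B|`, hence to 1, modulo `d`, and it is not 1 because `B`
is split. -/
theorem lt_card_filter_subset (h : P ≤ Q) (hP : ∀ C ∈ P.parts, C.card ≡ 1 [MOD d])
    (hQ : ∀ C ∈ Q.parts, C.card ≡ 1 [MOD d]) {B : Finset ℕ} (hB : B ∈ Q.parts)
    (hBP : B ∉ P.parts) : d + 1 ≤ {C ∈ P.parts | C ⊆ B}.card := by
  have h1 := (card_filter_subset_modEq h hP hB).trans (hQ B hB)
  have h2 := card_filter_subset_pos h hB
  have h3 : {C ∈ P.parts | C ⊆ B}.card ≠ 1 := by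
    intro h3
    obtain ⟨C, hC⟩ := Finset.card_eq_one.1 h3
    have h4 := biUnion_filter_subset h hB
    rw [hC, Finset.singleton_biUnion] at h4
    have h5 : C ∈ {C ∈ P.parts | C ⊆ B} := by rw [hC]; exact Finset.mem_singleton_self C
    exact hBP (h4 ▸ (Finset.mem_filter.1 h5).1)
  have h4 := (Nat.modEq_iff_dvd' h2).1 h1.symm
  have := Nat.le_of_dvd (by omega) h4
  omega

theorem eq_of_le_of_parts_subset (h : P ≤ Q) (hs : Q.parts ⊆ P.parts) : P = Q := by
  refine le_antisymm h fun B hB => ⟨B, hs hB, le_rfl⟩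

theorem exists_mem_parts_notMem_parts (h : P ≤ Q) (hne : P ≠ Q) : ∃ B ∈ Q.parts, B ∉ P.parts := by
  by_contra! hs
  exact hne (eq_of_le_of_parts_subset h hs)

theorem card_parts_add_le (h : P ≤ Q) (hne : P ≠ Q) (hP : ∀ C ∈ P.parts, C.card ≡ 1 [MOD d])
    (hQ : ∀ C ∈ Q.parts, C.card ≡ 1 [MOD d]) : Q.parts.card + d ≤ P.parts.card := by
  obtain ⟨B, hB, hBP⟩ := exists_mem_parts_notMem_parts h hne
  rw [← sum_card_filter_subset h, ← Finset.add_sum_erase _ _ hB, ← Finset.card_erase_add_one hB]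
  have h1 := lt_card_filter_subset h hP hQ hB hBP
  have h2 : (Q.parts.erase B).card ≤ ∑ x ∈ Q.parts.erase B, {C ∈ P.parts | C ⊆ x}.card :=
    (Finset.card_eq_sum_ones _).trans_le <| Finset.sum_le_sum fun D hD => card_filter_subset_pos h (Finset.mem_of_mem_erase hD)
  omega

/-- If all parts of `P ≤ Q` have cardinality `1` modulo `d` and `P` has `d` more parts than `Q`,
then only one part of `Q` is not a part of `P`, and it splits into `d + 1` parts. -/
theorem exists_unique_split (hd : 0 < d) (h : P ≤ Q) (hP : ∀ C ∈ P.parts, C.card ≡ 1 [MOD d])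
    (hQ : ∀ C ∈ Q.parts, C.card ≡ 1 [MOD d]) (hc : P.parts.card = Q.parts.card + d) :
    ∃ B ∈ Q.parts, B ∉ P.parts ∧ (∀ C ∈ Q.parts, C ≠ B → C ∈ P.parts) ∧
      {C ∈ P.parts | C ⊆ B}.card = d + 1 := by
  obtain ⟨B, hB, hBP⟩ := exists_mem_parts_notMem_parts h (by rintro rfl; omega)
  have h1 := lt_card_filter_subset h hP hQ hB hBP
  rw [← sum_card_filter_subset h, ← Finset.add_sum_erase _ _ hB, ← Finset.card_erase_add_one hB] at hc
  have h2 : (Q.parts.erase B).card ≤ ∑ x ∈ Q.parts.erase B, {C ∈ P.parts | C ⊆ x}.card :=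
    (Finset.card_eq_sum_ones _).trans_le <| Finset.sum_le_sum fun D hD => card_filter_subset_pos h (Finset.mem_of_mem_erase hD)
  refine ⟨B, hB, hBP, ?_, by omega⟩
  intro D hD hDB
  by_contra hDP
  have h3 := lt_card_filter_subset h hP hQ hD hDP
  have h4 : (Q.parts.erase B).card < ∑ x ∈ Q.parts.erase B, {C ∈ P.parts | C ⊆ x}.card :=
    (Finset.card_eq_sum_ones _).trans_lt <| Finset.sum_lt_sum
      (fun D hD => card_filter_subset_pos h (Finset.mem_of_mem_erase hD))
      ⟨D, Finset.mem_erase.2 ⟨hDB, hD⟩, by omega⟩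
  omega

end Finpartition

/-! ### The Kreweras dual and the shape of a single step. -/

section Kreweras

variable {n d : ℕ} {π σ : Finpartition (Finset.Icc 1 n)}

theorem exists_mem_krewerasDual_iff {x y : ℕ} :
    (∃ D ∈ (krewerasDual π).parts, x ∈ D ∧ y ∈ D) ↔
      x ∈ Finset.Icc 1 n ∧ y ∈ Finset.Icc 1 n ∧ (krewerasSetoid π).r x y := by
  classical
  rw [← Finpartition.mem_part_ofSetSetoid_iff_rel, Finpartition.mem_part_iff_exists]
  exact exists_congr fun D => and_congr Iff.rfl and_comm

theorem krewerasSetoid_of_le (h : π ≤ σ) {x y : ℕ} (hxy : (krewerasSetoid σ).r x y) :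
    (krewerasSetoid π).r x y := by
  intro B hB a ha b hb
  obtain ⟨C, hC, hBC⟩ := h hB
  exact hxy C hC a (hBC ha) b (hBC hb)

theorem krewerasDual_antitone (h : π ≤ σ) : krewerasDual σ ≤ krewerasDual π := by
  intro D hD
  obtain ⟨x, hx⟩ := (krewerasDual σ).nonempty_of_mem_parts hD
  obtain ⟨E, hE, hxE⟩ := (krewerasDual π).exists_mem ((krewerasDual σ).subset hD hx)
  refine ⟨E, hE, fun y hy => ?_⟩
  obtain ⟨hx', hy', hxy⟩ := exists_mem_krewerasDual_iff.1 ⟨D, hD, hx, hy⟩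
  obtain ⟨E', hE', hxE', hyE'⟩ :=
    exists_mem_krewerasDual_iff.2 ⟨hx', hy', krewerasSetoid_of_le h hxy⟩
  rwa [(krewerasDual π).eq_of_mem_parts hE hE' hxE hxE']

/-- The half-open interval `(x, y]` contains `y` but not `x`. -/
theorem not_krewerasSetoid_of_mem {B : Finset ℕ} (hB : B ∈ σ.parts) {x y : ℕ} (hx : x ∈ B)
    (hy : y ∈ B) (hxy : x < y) : ¬ (krewerasSetoid σ).r x y := by
  intro h
  have := h B hB x hx y hy
  rw [min_eq_left hxy.le, max_eq_right hxy.le, Finset.mem_Ioc, Finset.mem_Ioc] at this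
  omega

/-- If `C` is a block of `π` contained in the block `B` of `σ` and `x` is the predecessor of `min C`
in `B`, then `x'` and `(max C)'` lie in the same block of the Kreweras dual of `π`. -/
theorem krewerasSetoid_pred_max (hπ : IsNoncrossing π) (hσ : IsNoncrossing σ) (h : π ≤ σ)
    {B C : Finset ℕ} (hB : B ∈ σ.parts) (hC : C ∈ π.parts) {x y z : ℕ}
    (hCB : C ⊆ B)
    (hy : y ∈ C) (hyC : ∀ b ∈ C, y ≤ b) (hz : z ∈ C) (hzC : ∀ b ∈ C, b ≤ z)
    (hx : x ∈ B) (hxy : x < y) (hxB : ∀ b ∈ B, ¬ (x < b ∧ b < y)) :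
    (krewerasSetoid π).r x z := by
  have hyz := hyC z hz
  have key : ∀ E ∈ π.parts, ∀ a ∈ E, ∀ b ∈ E, a ∈ Finset.Ioc x z → b ∈ Finset.Ioc x z := by
    intro E hE a ha b hb hax
    rw [Finset.mem_Ioc] at *
    -- Leaving `(x, z]`, a block inside `B` would cross `C` in `π`, as `B` has no points in `(x,
    -- y)`; a block outside `B` would cross `B` in `σ` at `x` and `z`.
    by_cases hEB : E ⊆ B
    · by_cases hEC : E = C
      · subst hEC
        have := hyC b hb
        have := hzC b hb
        omega
      · have hne : ∀ c ∈ C, ∀ e ∈ E, e ≠ c := by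
          rintro c hc e he rfl
          exact hEC (π.eq_of_mem_parts hE hC he hc)
        have h1 := hxB a (hEB ha)
        have h2 := hne y hy a ha
        have h3 := hne z hz a ha
        have h4 := hne y hy b hb
        have h5 := hne z hz b hb
        by_contra hbx
        by_cases hby : b < y
        · exact hπ E hE C hC hEC ⟨b, y, a, z, by omega, by omega, by omega, hb, ha, hy, hz⟩
        · exact hπ C hC E hE (Ne.symm hEC)
            ⟨y, a, z, b, by omega, by omega, by omega, hy, hz, ha, hb⟩
    · obtain ⟨F, hF, hEF⟩ := h hE
      have hFB : F ≠ B := by rintro rfl; exact hEB hEF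
      have hne : ∀ c ∈ B, ∀ e ∈ E, e ≠ c := by
        rintro c hc e he rfl
        exact hFB (σ.eq_of_mem_parts hF hB (hEF he) hc)
      have h3 := hne z (hCB hz) a ha
      have h4 := hne x hx b hb
      by_contra hbx
      by_cases hby : b < x
      · exact hσ F hF B hB hFB
          ⟨b, x, a, z, by omega, by omega, by omega, hEF hb, hEF ha, hx, hCB hz⟩
      · exact hσ B hB F hF (Ne.symm hFB)
          ⟨x, a, z, b, by omega, by omega, by omega, hx, hCB hz, hEF ha, hEF hb⟩
  intro E hE a ha b hb
  rw [min_eq_left (by omega), max_eq_right (by omega)]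
  exact ⟨key E hE a ha b hb, key E hE b hb a ha⟩

theorem Finset.exists_pred_mem {B : Finset ℕ} {b y : ℕ} (hb : b ∈ B) (hby : b < y) :
    ∃ x ∈ B, x < y ∧ ∀ c ∈ B, ¬ (x < c ∧ c < y) := by
  obtain ⟨x, hx, hmax⟩ := (B.filter (· < y)).exists_max_image id
    ⟨b, Finset.mem_filter.2 ⟨hb, hby⟩⟩
  rw [Finset.mem_filter] at hx
  refine ⟨x, hx.1, hx.2, fun c hc h => ?_⟩
  have := hmax c (Finset.mem_filter.2 ⟨hc, h.2⟩)
  simp only [id] at this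
  omega

/-- In a split block `B`, take a piece `C` without `min B` and the predecessor `x` of `min C` in
`B`: the points `x'` and `(max C)'` are related for `π` but separated by `B` for `σ`. -/
theorem krewerasDual_ne (hπ : IsNoncrossing π) (hσ : IsNoncrossing σ) (h : π ≤ σ) (hne : π ≠ σ) :
    krewerasDual σ ≠ krewerasDual π := by
  intro he
  obtain ⟨B, hB, hBπ⟩ := Finpartition.exists_mem_parts_notMem_parts h hne
  obtain ⟨b, hb, hbB⟩ := B.exists_min_image id (σ.nonempty_of_mem_parts hB)
  obtain ⟨E, hE, hbE⟩ := π.exists_mem (σ.subset hB hb)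
  have hEB := Finpartition.subset_of_le_of_mem h hE hB hbE hb
  obtain ⟨c, hcB, hcE⟩ : ∃ c ∈ B, c ∉ E := by
    by_contra! hBE
    exact hBπ (hEB.antisymm hBE ▸ hE)
  obtain ⟨C, hC, hcC⟩ := π.exists_mem (σ.subset hB hcB)
  have hCB := Finpartition.subset_of_le_of_mem h hC hB hcC hcB
  obtain ⟨y, hy, hyC⟩ := C.exists_min_image id ⟨c, hcC⟩
  obtain ⟨z, hz, hzC⟩ := C.exists_max_image id ⟨c, hcC⟩
  have hby : b < y := by
    refine lt_of_le_of_ne (hbB y (hCB hy)) ?_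
    rintro rfl
    exact hcE (π.eq_of_mem_parts hE hC hbE hy ▸ hcC)
  obtain ⟨x, hx, hxy, hxB⟩ := Finset.exists_pred_mem hb hby
  have hr := krewerasSetoid_pred_max hπ hσ h hB hC hCB hy hyC hz hzC hx hxy hxB
  obtain ⟨D, hD, hxD, hzD⟩ := exists_mem_krewerasDual_iff.2
    ⟨σ.subset hB hx, σ.subset hB (hCB hz), hr⟩
  rw [← he] at hD
  exact not_krewerasSetoid_of_mem hB hx (hCB hz) (lt_of_lt_of_le hxy (hyC z hz))
    (exists_mem_krewerasDual_iff.1 ⟨D, hD, hxD, hzD⟩).2.2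

/-- The block `B` of `σ` is the union of `d + 1` blocks of `π`, the other blocks of `σ` are blocks
of `π`, the number `a` belongs to the block `B₁` among the joined ones and is smaller than
the elements of the other joined blocks, whose minima lie between `a` and the next element of `B₁`
and are not nested. -/
structure IsMerge (d : ℕ) (π σ : Finpartition (Finset.Icc 1 n)) (B B₁ : Finset ℕ) (a : ℕ) :
    Prop where
  le : π ≤ σ
  mem_parts : B ∈ σ.parts
  notMem_parts : B ∉ π.parts
  mem_parts_of_ne : ∀ C ∈ σ.parts, C ≠ B → C ∈ π.parts
  card_eq : {C ∈ π.parts | C ⊆ B}.card = d + 1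
  fst_mem : B₁ ∈ π.parts
  fst_subset : B₁ ⊆ B
  label_mem : a ∈ B₁
  lt : ∀ C ∈ π.parts, C ⊆ B → C ≠ B₁ → ∀ x ∈ C, a < x
  gap : ∀ C ∈ π.parts, C ⊆ B → C ≠ B₁ → ∀ x ∈ C, (∀ y ∈ C, x ≤ y) → ∀ b ∈ B₁, ¬ (a < b ∧ b < x)
  not_nested : ∀ C ∈ π.parts, C ⊆ B → C ≠ B₁ → ∀ C' ∈ π.parts, C' ⊆ B → C' ≠ B₁ → C ≠ C' →
    ∀ x ∈ C, (∀ y ∈ C, x ≤ y) → ∀ w ∈ C', ∀ z ∈ C', ¬ (w < x ∧ x < z)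

theorem sdiff_parts_eq (h : π ≤ σ) {B : Finset ℕ} (hB : B ∈ σ.parts) (hBπ : B ∉ π.parts)
    (hσ : ∀ C ∈ σ.parts, C ≠ B → C ∈ π.parts) :
    π.parts \ σ.parts = {C ∈ π.parts | C ⊆ B} := by
  ext C
  rw [Finset.mem_sdiff, Finset.mem_filter]
  refine and_congr_right fun hC => ?_
  obtain ⟨x, hx⟩ := π.nonempty_of_mem_parts hC
  constructor
  · intro hCσ
    obtain ⟨E, hE, hCE⟩ := h hC
    by_cases hEB : E = B
    · exact hEB ▸ hCE
    · have := π.eq_of_mem_parts hC (hσ E hE hEB) hx (hCE hx)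
      exact absurd (this ▸ hE) hCσ
  · intro hCB hCσ
    exact hBπ (σ.eq_of_mem_parts hCσ hB hx (hCB hx) ▸ hC)

theorem edgeLabel_spec (h : π ≤ σ) {B : Finset ℕ} (hB : B ∈ σ.parts)
    (hJ : π.parts \ σ.parts = {C ∈ π.parts | C ⊆ B}) :
    ∃ B₁ ∈ π.parts, B₁ ⊆ B ∧ edgeLabel π σ ∈ B₁ ∧
      (∀ C ∈ π.parts, C ⊆ B → C ≠ B₁ → ∀ x ∈ C, edgeLabel π σ < x) ∧
      ∀ b ∈ B₁, (∀ C ∈ π.parts, C ⊆ B → C ≠ B₁ → ∀ x ∈ C, b < x) → b ≤ edgeLabel π σ := by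
  set A := {i : ℕ | ∃ B ∈ π.parts \ σ.parts, i ∈ B ∧
    ∀ C ∈ π.parts \ σ.parts, C ≠ B → ∀ x ∈ C, i < x} with hA
  have hAB : BddAbove A := by
    refine ⟨n, ?_⟩
    rintro i ⟨C, hC, hi, -⟩
    exact (Finset.mem_Icc.1 (π.subset (Finset.mem_sdiff.1 hC).1 hi)).2
  have hAne : A.Nonempty := by
    obtain ⟨b, hb, hbB⟩ := B.exists_min_image id (σ.nonempty_of_mem_parts hB)
    obtain ⟨E, hE, hbE⟩ := π.exists_mem (σ.subset hB hb)
    have hEB := Finpartition.subset_of_le_of_mem h hE hB hbE hb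
    refine ⟨b, E, by rw [hJ]; exact Finset.mem_filter.2 ⟨hE, hEB⟩, hbE, fun C hC hCE x hx => ?_⟩
    rw [hJ, Finset.mem_filter] at hC
    refine lt_of_le_of_ne (hbB x (hC.2 hx)) ?_
    rintro rfl
    exact hCE (π.eq_of_mem_parts hC.1 hE hx hbE)
  -- A supremum in `ℕ` is attained only for nonempty bounded sets; `min B` provides nonemptiness.
  have hm : edgeLabel π σ ∈ A := Nat.sSup_mem hAne hAB
  obtain ⟨B₁, hB₁, ha, hlt⟩ := hm
  rw [hJ, Finset.mem_filter] at hB₁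
  refine ⟨B₁, hB₁.1, hB₁.2, ha, fun C hC hCB hne => hlt C ?_ hne, fun b hb hbl => ?_⟩
  · rw [hJ]; exact Finset.mem_filter.2 ⟨hC, hCB⟩
  · refine le_csSup hAB ⟨B₁, by rw [hJ]; exact Finset.mem_filter.2 hB₁, hb, fun C hC hne => ?_⟩
    rw [hJ, Finset.mem_filter] at hC
    exact hbl C hC.1 hC.2 hne

/-- Let `D` be the only block of the dual of `π` that splits in the dual of `σ`. Related points
`x'`, `z'` with `x`, `z` in `B` are separated in `σ`, so they lie in `D`. Hence `D` contains the
predecessors in `B` of the minima of the joined blocks other than `B₁`, the maxima of these blocks,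
and `a`. No block of `π` separates points of `D`, which gives `gap` and `not_nested`. -/
theorem exists_isMerge (hd : 0 < d) (hπ : IsIndivisible d π) (hσ : IsIndivisible d σ) (h : π ≤ σ)
    (hc : π.parts.card = σ.parts.card + d)
    (hc' : (krewerasDual σ).parts.card = (krewerasDual π).parts.card + d) :
    ∃ B B₁, IsMerge d π σ B B₁ (edgeLabel π σ) := by
  obtain ⟨B, hB, hBπ, hother, hcard⟩ := Finpartition.exists_unique_split hd h hπ.2.1 hσ.2.1 hc
  obtain ⟨B₁, hB₁, hB₁B, ha, hlt, hmax⟩ :=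
    edgeLabel_spec h hB (sdiff_parts_eq h hB hBπ hother)
  set a := edgeLabel π σ
  obtain ⟨D, hD, hDσ, hDother, -⟩ := Finpartition.exists_unique_split hd (krewerasDual_antitone h)
    hσ.2.2 hπ.2.2 hc'
  have memD : ∀ x ∈ B, ∀ z ∈ B, x < z → (krewerasSetoid π).r x z → x ∈ D ∧ z ∈ D := by
    intro x hx z hz hxz hr
    obtain ⟨E, hE, hxE, hzE⟩ := exists_mem_krewerasDual_iff.2
      ⟨σ.subset hB hx, σ.subset hB hz, hr⟩
    by_cases hED : E = D
    · exact hED ▸ ⟨hxE, hzE⟩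
    · exact absurd (exists_mem_krewerasDual_iff.1 ⟨E, hDother E hE hED, hxE, hzE⟩).2.2
        (not_krewerasSetoid_of_mem hB hx hz hxz)
  have rel : ∀ {x z}, x ∈ D → z ∈ D → (krewerasSetoid π).r x z := fun hx hz =>
    (exists_mem_krewerasDual_iff.1 ⟨D, hD, hx, hz⟩).2.2
  have predD : ∀ C ∈ π.parts, C ⊆ B → C ≠ B₁ → ∀ y ∈ C, (∀ b ∈ C, y ≤ b) →
      ∃ x ∈ B, x < y ∧ (∀ c ∈ B, ¬ (x < c ∧ c < y)) ∧ x ∈ D ∧ ∃ z ∈ C, (∀ b ∈ C, b ≤ z) ∧ z ∈ D := by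
    intro C hC hCB hne y hy hyC
    obtain ⟨z, hz, hzC⟩ := C.exists_max_image id ⟨y, hy⟩
    obtain ⟨x, hx, hxy, hxB⟩ := Finset.exists_pred_mem (hB₁B ha) (hlt C hC hCB hne y hy)
    have hm := memD x hx z (hCB hz) (lt_of_lt_of_le hxy (hyC z hz))
      (krewerasSetoid_pred_max hπ.1 hσ.1 h hB hC hCB hy hyC hz hzC hx hxy hxB)
    exact ⟨x, hx, hxy, hxB, hm.1, z, hz, hzC, hm.2⟩
  -- By maximality, the label is the predecessor in `B` of the smallest element of `B \ B₁`.
  have haD : a ∈ D := by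
    have hne : (B \ B₁).Nonempty := by
      rw [Finset.sdiff_nonempty]
      intro hs
      exact hBπ (hB₁B.antisymm hs ▸ hB₁)
    obtain ⟨y, hy, hyB⟩ := (B \ B₁).exists_min_image id hne
    rw [Finset.mem_sdiff] at hy
    obtain ⟨C, hC, hyC⟩ := π.exists_mem (σ.subset hB hy.1)
    have hCB := Finpartition.subset_of_le_of_mem h hC hB hyC hy.1
    have hout : ∀ E ∈ π.parts, E ⊆ B → E ≠ B₁ → ∀ x ∈ E, y ≤ x := fun E hE hEB hne x hx =>
      hyB x (Finset.mem_sdiff.2 ⟨hEB hx, fun hx' => hne (π.eq_of_mem_parts hE hB₁ hx hx')⟩)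
    have hCB₁ : C ≠ B₁ := by rintro rfl; exact hy.2 hyC
    obtain ⟨x, hx, hxy, hxB, hxD, -⟩ := predD C hC hCB hCB₁ y hyC (hout C hC hCB hCB₁)
    have hxB₁ : x ∈ B₁ := by
      by_contra hx'
      have := hyB x (Finset.mem_sdiff.2 ⟨hx, hx'⟩)
      simp only [id] at this
      omega
    have h1 := hmax x hxB₁ fun E hE hEB hne c hc => lt_of_lt_of_le hxy (hout E hE hEB hne c hc)
    have h2 := hlt C hC hCB hCB₁ y hyC
    have h3 := hxB a (hB₁B ha)
    obtain rfl : x = a := by omega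
    exact hxD
  refine ⟨B, B₁, h, hB, hBπ, hother, hcard, hB₁, hB₁B, ha, hlt, ?_, ?_⟩
  · rintro C hC hCB hne y hy hyC b hb ⟨hab, hby⟩
    obtain ⟨x, hx, hxy, hxB, hxD, -⟩ := predD C hC hCB hne y hy hyC
    have h1 := hxB b (hB₁B hb)
    have h2 := rel haD hxD B₁ hB₁ a ha b hb
    rw [min_eq_left (by omega), max_eq_right (by omega), Finset.mem_Ioc, Finset.mem_Ioc] at h2
    omega
  · rintro C hC hCB hne C' hC' hCB' hne' hCC' y hy hyC w hw v hv ⟨hwy, hyv⟩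
    obtain ⟨x, hx, hxy, hxB, hxD, -⟩ := predD C hC hCB hne y hy hyC
    obtain ⟨y', hy', hyC'⟩ := C'.exists_min_image id ⟨w, hw⟩
    obtain ⟨-, -, -, -, -, z, hz, hzC, hzD⟩ := predD C' hC' hCB' hne' y' hy' hyC'
    have h1 := hxB w (hCB' hw)
    have h2 := rel hxD hzD C' hC' w hw v hv
    have h3 := hzC v hv
    rw [min_eq_left (by omega), max_eq_right (by omega), Finset.mem_Ioc, Finset.mem_Ioc] at h2
    omega

/-- The minima of the blocks of `π`. -/
def minima (π : Finpartition (Finset.Icc 1 n)) : Finset ℕ :=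
  {x ∈ Finset.Icc 1 n | ∀ B ∈ π.parts, x ∈ B → ∀ y ∈ B, x ≤ y}

theorem card_minima : (minima π).card = π.parts.card := by
  symm
  refine Finset.card_bij (fun B hB => B.min' (π.nonempty_of_mem_parts hB)) ?_ ?_ ?_
  · intro B hB
    have hm := B.min'_mem (π.nonempty_of_mem_parts hB)
    refine Finset.mem_filter.2 ⟨π.subset hB hm, fun C hC hmC y hy => ?_⟩
    obtain rfl := π.eq_of_mem_parts hB hC hm hmC
    exact B.min'_le y hy
  · intro B hB C hC he
    exact π.eq_of_mem_parts hB hC (B.min'_mem (π.nonempty_of_mem_parts hB))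
      (he ▸ C.min'_mem (π.nonempty_of_mem_parts hC))
  · intro x hx
    obtain ⟨hx, hmin⟩ := Finset.mem_filter.1 hx
    obtain ⟨B, hB, hxB⟩ := π.exists_mem hx
    exact ⟨B, hB, le_antisymm (B.min'_le x hxB) (B.le_min' _ _ (hmin B hB hxB))⟩

theorem minima_antitone (h : π ≤ σ) : minima σ ⊆ minima π := by
  intro x hx
  obtain ⟨hx, hmin⟩ := Finset.mem_filter.1 hx
  refine Finset.mem_filter.2 ⟨hx, fun B hB hxB y hy => ?_⟩
  obtain ⟨C, hC, hBC⟩ := h hB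
  exact hmin C hC (hBC hxB) y (hBC hy)

namespace IsMerge

variable {B B₁ : Finset ℕ} {a : ℕ}

/-- The minimum of `B` lies in `B₁`, so exactly the other joined blocks lose their minima. -/
theorem mem_minima_sdiff_iff (h : IsMerge d π σ B B₁ a) {x : ℕ} :
    x ∈ minima π \ minima σ ↔
      ∃ C ∈ π.parts, C ⊆ B ∧ C ≠ B₁ ∧ x ∈ C ∧ ∀ y ∈ C, x ≤ y := by
  rw [Finset.mem_sdiff]
  constructor
  · rintro ⟨hx, hxσ⟩
    obtain ⟨hx, hmin⟩ := Finset.mem_filter.1 hx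
    obtain ⟨C, hC, hxC⟩ := π.exists_mem hx
    obtain ⟨E, hE, hxE⟩ := σ.exists_mem hx
    have hEB : E = B := by
      by_contra hEB
      refine hxσ (Finset.mem_filter.2 ⟨hx, fun F hF hxF => ?_⟩)
      obtain rfl := σ.eq_of_mem_parts hE hF hxE hxF
      exact hmin E (h.mem_parts_of_ne E hE hEB) hxE
    subst hEB
    refine ⟨C, hC, Finpartition.subset_of_le_of_mem h.le hC hE hxC hxE, ?_, hxC, hmin C hC hxC⟩
    rintro rfl
    refine hxσ (Finset.mem_filter.2 ⟨hx, fun F hF hxF y hy => ?_⟩)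
    obtain rfl := σ.eq_of_mem_parts hE hF hxE hxF
    obtain ⟨G, hG, hyG⟩ := π.exists_mem (σ.subset hE hy)
    by_cases hGC : G = C
    · exact hmin C hC hxC y (hGC ▸ hyG)
    · have h1 := h.lt G hG (Finpartition.subset_of_le_of_mem h.le hG hE hyG hy) hGC y hyG
      have h2 := hmin C hC hxC a h.label_mem
      omega
  · rintro ⟨C, hC, hCB, hne, hxC, hmin⟩
    refine ⟨Finset.mem_filter.2 ⟨π.subset hC hxC, fun E hE hxE => ?_⟩, fun hx => ?_⟩
    · rwa [π.eq_of_mem_parts hE hC hxE hxC]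
    · have h1 := (Finset.mem_filter.1 hx).2 B h.mem_parts (hCB hxC) a (h.fst_subset h.label_mem)
      have h2 := h.lt C hC hCB hne x hxC
      omega

theorem blocksMeeting_eq (h : IsMerge d π σ B B₁ a) :
    blocksMeeting π (insert a (minima π \ minima σ)) = {C ∈ π.parts | C ⊆ B} := by
  ext C
  rw [blocksMeeting, Finset.mem_filter, Finset.mem_filter]
  refine and_congr_right fun hC => ?_
  constructor
  · rintro ⟨x, hx, hxC⟩
    rcases Finset.mem_insert.1 hx with rfl | hx
    · exact π.eq_of_mem_parts h.fst_mem hC h.label_mem hxC ▸ h.fst_subset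
    · obtain ⟨E, hE, hEB, -, hxE, -⟩ := h.mem_minima_sdiff_iff.1 hx
      exact π.eq_of_mem_parts hE hC hxE hxC ▸ hEB
  · intro hCB
    by_cases hne : C = B₁
    · exact ⟨a, Finset.mem_insert_self _ _, hne ▸ h.label_mem⟩
    · obtain ⟨x, hx, hmin⟩ := C.exists_min_image id (π.nonempty_of_mem_parts hC)
      exact ⟨x, Finset.mem_insert_of_mem (h.mem_minima_sdiff_iff.2 ⟨C, hC, hCB, hne, hx, hmin⟩), hx⟩

theorem parts_eq (h : IsMerge d π σ B B₁ a) :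
    σ.parts = insert ({C ∈ π.parts | C ⊆ B}.sup id) (π.parts \ {C ∈ π.parts | C ⊆ B}) := by
  rw [Finset.sup_eq_biUnion, Finpartition.biUnion_filter_subset h.le h.mem_parts,
    ← sdiff_parts_eq h.le h.mem_parts h.notMem_parts h.mem_parts_of_ne, Finset.sdiff_sdiff_self_left]
  ext C
  rw [Finset.mem_insert, Finset.mem_inter]
  constructor
  · intro hC
    by_cases hCB : C = B
    · exact Or.inl hCB
    · exact Or.inr ⟨h.mem_parts_of_ne C hC hCB, hC⟩
  · rintro (rfl | hC)
    · exact h.mem_parts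
    · exact hC.2

end IsMerge

end Kreweras

/-- There are `k` drops of at least `d`, and the total drop is at most `d * k`, so every drop is
exactly `d`. -/
theorem Fin.add_mul_eq_of_succ_add_le {d k N : ℕ} {c : Fin (k + 1) → ℕ}
    (hc : ∀ i : Fin k, c i.succ + d ≤ c i.castSucc) (h0 : c 0 ≤ d * k + N)
    (hk : N ≤ c (Fin.last k)) (i : Fin (k + 1)) : c i + d * i = d * k + N := by
  have ha : Antitone fun i : Fin (k + 1) => c i + d * i := by
    rw [Fin.antitone_iff_succ_le]
    intro i
    have := hc i
    simp only [Fin.val_succ, Fin.val_castSucc]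
    linarith
  have h1 := ha (Fin.zero_le i)
  have h2 := ha (Fin.le_last i)
  simp only [Fin.val_zero, Fin.val_last] at h1 h2
  omega

theorem ParkingTree.stepGraph_adj {d k : ℕ} {V : Type*} {T : ParkingTree d k V} {i : ℕ} {u v : V} :
    (T.stepGraph i).Adj u v ↔ u ≠ v ∧
      ((∃ (j : Fin k) (s : Fin d), (j : ℕ) < i ∧ v = T.vertex j s ∧ T.parent v = some u) ∨
        ∃ (j : Fin k) (s : Fin d), (j : ℕ) < i ∧ u = T.vertex j s ∧ T.parent u = some v) :=
  SimpleGraph.fromRel_adj _ _ _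

/-! ### The arcs of a maximal chain. -/

namespace MaximalChainNC

variable {d k : ℕ} (m : MaximalChainNC d k)

theorem elem_monotone : Monotone fun i => (m.elem i).1 :=
  Fin.monotone_iff_le_succ.2 fun i => (m.covBy i).le

theorem card_parts_add (i : Fin (k + 1)) :
    (m.elem i).1.parts.card + d * i = d * k + 1 := by
  refine Fin.add_mul_eq_of_succ_add_le (c := fun i => (m.elem i).1.parts.card) (fun i => ?_) ?_ ?_ i
  · exact Finpartition.card_parts_add_le (m.covBy i).le
      (fun h => (m.covBy i).ne (Subtype.ext h)) (m.elem _).2.2.1 (m.elem _).2.2.1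
  · simpa using (m.elem 0).1.card_parts_le_card
  · exact Finset.card_pos.2 (Finpartition.parts_nonempty _ (by simp))

theorem card_krewerasDual_parts (i : Fin (k + 1)) :
    (krewerasDual (m.elem i).1).parts.card = d * i + 1 := by
  have hle : ∀ i, (krewerasDual (m.elem i).1).parts.card ≤ d * k + 1 := fun i => by
    simpa using (krewerasDual (m.elem i).1).card_parts_le_card
  have hpos : 0 < (krewerasDual (m.elem 0).1).parts.card :=
    Finset.card_pos.2 (Finpartition.parts_nonempty _ (by simp))
  -- The dual count grows along the chain and lies in `[1, dk + 1]`; reflecting it by `dk + 2` gives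
  -- a decreasing count in the same range.
  have h := Fin.add_mul_eq_of_succ_add_le (d := d) (N := 1)
    (c := fun i => d * k + 2 - (krewerasDual (m.elem i).1).parts.card) (fun i => ?_) ?_ ?_ i
  · have := hle i
    have : d * i ≤ d * k := Nat.mul_le_mul_left d (by omega)
    omega
  · have h1 := Finpartition.card_parts_add_le (d := d) (krewerasDual_antitone (m.covBy i).le)
      (krewerasDual_ne (m.elem _).2.1 (m.elem _).2.1 (m.covBy i).le
        (fun h => (m.covBy i).ne (Subtype.ext h))) (m.elem _).2.2.2 (m.elem _).2.2.2
    have h2 := hle i.succ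
    omega
  · omega
  · have := hle (Fin.last k)
    omega

theorem exists_isMerge (hd : 0 < d) (i : Fin k) : ∃ B B₁,
    IsMerge d (m.elem i.castSucc).1 (m.elem i.succ).1 B B₁ (m.labels i) := by
  refine _root_.exists_isMerge hd (m.elem _).2 (m.elem _).2 (m.covBy i).le ?_ ?_
  · have h1 := m.card_parts_add i.castSucc
    have h2 := m.card_parts_add i.succ
    simp only [Fin.val_succ, Fin.val_castSucc, mul_add] at h1 h2
    omega
  · rw [m.card_krewerasDual_parts, m.card_krewerasDual_parts]
    simp only [Fin.val_succ, Fin.val_castSucc]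
    ring

/-- The minima of the blocks that are joined in the step from `elem i` to `elem (i + 1)`, except for
the smallest one. -/
def joinedMinima (i : Fin k) : Finset ℕ :=
  minima (m.elem i.castSucc).1 \ minima (m.elem i.succ).1

theorem minima_zero : minima (m.elem 0).1 = Finset.Icc 1 (d * k + 1) := by
  refine Finset.eq_of_subset_of_card_le (Finset.filter_subset _ _) ?_
  have := m.card_parts_add 0
  rw [card_minima, Nat.card_Icc]
  simp only [Fin.val_zero] at this
  omega

theorem minima_last : minima (m.elem (Fin.last k)).1 = {1} := by
  symm
  refine Finset.eq_of_subset_of_card_le ?_ ?_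
  · rw [Finset.singleton_subset_iff]
    refine Finset.mem_filter.2 ⟨by simp, fun B hB _ y hy => ?_⟩
    exact (Finset.mem_Icc.1 (Finpartition.subset _ hB hy)).1
  · have := m.card_parts_add (Fin.last k)
    rw [card_minima, Finset.card_singleton]
    simp only [Fin.val_last] at this
    omega

theorem card_joinedMinima (i : Fin k) : (m.joinedMinima i).card = d := by
  rw [joinedMinima, Finset.card_sdiff_of_subset (minima_antitone (m.covBy i).le), card_minima,
    card_minima]
  have h1 := m.card_parts_add i.castSucc
  have h2 := m.card_parts_add i.succ
  simp only [Fin.val_succ, Fin.val_castSucc, mul_add] at h1 h2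
  omega

theorem joinedMinima_disjoint {i j : Fin k} {x : ℕ} (hi : x ∈ m.joinedMinima i)
    (hj : x ∈ m.joinedMinima j) : i = j := by
  have key : ∀ {i j : Fin k}, x ∈ m.joinedMinima i → x ∈ m.joinedMinima j → ¬ i < j := by
    intro i j hi hj hij
    rw [joinedMinima, Finset.mem_sdiff] at hi hj
    exact hi.2 (minima_antitone (m.elem_monotone (Fin.succ_le_castSucc_iff.2 hij)) hj.1)
  exact le_antisymm (not_lt.1 (key hj hi)) (not_lt.1 (key hi hj))

/-- The sets of minima shrink from `[n]` to `{1}`, so each `x ≥ 2` is lost at some step. -/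
theorem exists_mem_joinedMinima_iff {x : ℕ} :
    (∃ i, x ∈ m.joinedMinima i) ↔ x ∈ Finset.Icc 2 (d * k + 1) := by
  constructor
  · rintro ⟨i, hi⟩
    rw [joinedMinima, Finset.mem_sdiff] at hi
    have h1 := Finset.mem_Icc.1 (Finset.mem_filter.1 hi.1).1
    have h2 : x ≠ 1 := by
      rintro rfl
      refine hi.2 (minima_antitone (m.elem_monotone (Fin.le_last i.succ)) ?_)
      rw [m.minima_last]
      exact Finset.mem_singleton_self 1
    rw [Finset.mem_Icc]
    omega
  · intro hx
    rw [Finset.mem_Icc] at hx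
    by_contra! hnot
    have key : ∀ i, x ∈ minima (m.elem i).1 := by
      intro i
      induction i using Fin.induction with
      | zero => rw [m.minima_zero, Finset.mem_Icc]; omega
      | succ i ih =>
        by_contra hi
        exact hnot i (Finset.mem_sdiff.2 ⟨ih, hi⟩)
    have := key (Fin.last k)
    rw [m.minima_last, Finset.mem_singleton] at this
    omega

variable {m}

theorem labels_lt (hd : 0 < d) {i : Fin k} {x : ℕ} (hx : x ∈ m.joinedMinima i) :
    m.labels i < x := by
  obtain ⟨B, B₁, h⟩ := m.exists_isMerge hd i
  obtain ⟨C, hC, hCB, hne, hxC, -⟩ := h.mem_minima_sdiff_iff.1 hx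
  exact h.lt C hC hCB hne x hxC

theorem exists_block_of_lt (hd : 0 < d) {i j : Fin k} {x : ℕ} (hx : x ∈ m.joinedMinima i)
    (hij : i < j) : ∃ C ∈ (m.elem j.castSucc).1.parts, m.labels i ∈ C ∧ x ∈ C := by
  obtain ⟨B, B₁, h⟩ := m.exists_isMerge hd i
  obtain ⟨C, hC, hCB, hne, hxC, -⟩ := h.mem_minima_sdiff_iff.1 hx
  obtain ⟨E, hE, hBE⟩ := m.elem_monotone (Fin.succ_le_castSucc_iff.2 hij) h.mem_parts
  exact ⟨E, hE, hBE (h.fst_subset h.label_mem), hBE (hCB hxC)⟩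

theorem joinedMinima_noncrossing (hd : 0 < d) {i j : Fin k} {x z : ℕ} (hx : x ∈ m.joinedMinima i)
    (hz : z ∈ m.joinedMinima j) (hij : m.labels i < m.labels j) (hjx : m.labels j < x) :
    z ≤ x := by
  by_contra! hxz
  rcases lt_trichotomy i j with hlt | rfl | hlt
  -- The earlier step put label `i` and `x` into one block `C`, which must be joined at step `j`, or
  -- it would cross the new block. If `C` is `B₁`, then `x` violates `gap`; otherwise label `i` is
  -- too small for `lt`.
  · obtain ⟨C, hC, hu, hxC⟩ := exists_block_of_lt hd hx hlt
    obtain ⟨B, B₁, h⟩ := m.exists_isMerge hd j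
    obtain ⟨E, hE, hEB, hne, hzE, hmin⟩ := h.mem_minima_sdiff_iff.1 hz
    have hCB₁ : C ≠ B₁ := by
      rintro rfl
      exact h.gap E hE hEB hne z hzE hmin x hxC ⟨hjx, hxz⟩
    obtain ⟨F, hF, hCF⟩ := h.le hC
    have hFB : F = B := by
      by_contra hFB
      exact (m.elem j.succ).2.1 F hF B h.mem_parts hFB ⟨_, _, x, z, hij, hjx, hxz, hCF hu, hCF hxC,
        h.fst_subset h.label_mem, hEB hzE⟩
    have := h.lt C hC (hFB ▸ hCF) hCB₁ _ hu
    omega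
  · omega
  -- Now label `j` and `z` share a block `C` joined at step `i`. If it is `B₁`, then label `j`
  -- violates `gap`; otherwise `x` is a minimum nested inside `C`.
  · obtain ⟨C, hC, hw, hzC⟩ := exists_block_of_lt hd hz hlt
    obtain ⟨B, B₁, h⟩ := m.exists_isMerge hd i
    obtain ⟨E, hE, hEB, hne, hxE, hmin⟩ := h.mem_minima_sdiff_iff.1 hx
    obtain ⟨F, hF, hCF⟩ := h.le hC
    have hFB : F = B := by
      by_contra hFB
      exact (m.elem i.succ).2.1 B h.mem_parts F hF (Ne.symm hFB) ⟨_, _, x, z, hij, hjx, hxz,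
        h.fst_subset h.label_mem, hEB hxE, hCF hw, hCF hzC⟩
    have hCB₁ : C ≠ B₁ := by
      rintro rfl
      exact h.gap E hE hEB hne x hxE hmin _ hw ⟨hij, hjx⟩
    have hEC : E ≠ C := by
      rintro rfl
      have := hmin _ hw
      omega
    exact h.not_nested E hE hEB hne C hC (hFB ▸ hCF) hCB₁ hEC x hxE hmin _ hw z hzC ⟨hjx, hxz⟩

theorem joinedMinima_decreasing (hd : 0 < d) {i j : Fin k} {x z : ℕ} (hx : x ∈ m.joinedMinima i)
    (hz : z ∈ m.joinedMinima j) (hij : m.labels i = m.labels j) (hxz : x < z) : j ≤ i := by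
  by_contra! hlt
  obtain ⟨C, hC, hu, hxC⟩ := exists_block_of_lt hd hx hlt
  obtain ⟨B, B₁, h⟩ := m.exists_isMerge hd j
  obtain ⟨E, hE, hEB, hne, hzE, hmin⟩ := h.mem_minima_sdiff_iff.1 hz
  rw [hij] at hu
  -- The equal label makes the block of `x` the first block of step `j`, so `x` lies in its
  -- forbidden gap.
  obtain rfl := Finpartition.eq_of_mem_parts _ hC h.fst_mem hu h.label_mem
  exact h.gap E hE hEB hne z hzE hmin x hxC ⟨hij ▸ labels_lt hd hx, hxz⟩

theorem joinedMinima_eq_childSet (hd : 0 < d) {V : Type*} (T : ParkingTree d k V)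
    (hT : m.labels = T.parkingFunction) (i : Fin k) : m.joinedMinima i = T.childSet i := by
  ext x
  refine mem_iff_mem_of_noncrossing_arcs (X := Finset.Icc 2 (d * k + 1)) (a := m.labels)
    m.card_joinedMinima T.card_childSet (fun _ _ _ => m.joinedMinima_disjoint)
    (fun _ _ _ => T.childSet_disjoint) (fun _ => m.exists_mem_joinedMinima_iff)
    (fun _ => T.exists_mem_childSet_iff) (fun _ _ => labels_lt hd) ?_
    (fun _ _ _ _ => joinedMinima_noncrossing hd) ?_ (fun _ _ _ _ => joinedMinima_decreasing hd) ?_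
    x i
  · rw [hT]; exact fun _ _ => T.parkingFunction_lt
  · rw [hT]; exact fun _ _ _ _ => T.childSet_noncrossing
  · rw [hT]; exact fun _ _ _ _ => T.childSet_decreasing

/-! ### Blocks as connected components. -/

variable {V : Type*} {T : ParkingTree d k V}

theorem exists_block_of_reachable (hd : 0 < d) (hT : m.labels = T.parkingFunction)
    (i : Fin (k + 1)) {u v : V} (h : (T.stepGraph i).Reachable u v) {B : Finset ℕ}
    (hB : B ∈ (m.elem i).1.parts) (hu : T.order u ∈ B) : T.order v ∈ B := by
  have key : ∀ {u v : V} (j : Fin k) (s : Fin d), (j : ℕ) < i → v = T.vertex j s →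
      T.parent v = some u → ∃ E ∈ (m.elem i).1.parts, T.order u ∈ E ∧ T.order v ∈ E := by
    rintro u v j s hj rfl hp
    obtain rfl : T.commonParent j = u := by simpa [T.parent_vertex] using hp
    have hv : T.order (T.vertex j s) ∈ m.joinedMinima j := by
      rw [joinedMinima_eq_childSet hd T hT]
      exact T.mem_childSet.2 ⟨s, rfl⟩
    obtain ⟨F, F₁, hF⟩ := m.exists_isMerge hd j
    obtain ⟨C, hC, hCF, -, hvC, -⟩ := hF.mem_minima_sdiff_iff.1 hv
    obtain ⟨E, hE, hFE⟩ := m.elem_monotone (show j.succ ≤ i from Nat.succ_le_of_lt hj) hF.mem_parts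
    have hu : T.order (T.commonParent j) ∈ F := by
      have := hF.fst_subset hF.label_mem
      rwa [hT] at this
    exact ⟨E, hE, hFE hu, hFE (hCF hvC)⟩
  rw [SimpleGraph.reachable_iff_reflTransGen] at h
  induction h with
  | refl => exact hu
  | tail _ hbc ih =>
    rw [ParkingTree.stepGraph_adj] at hbc
    rcases hbc.2 with ⟨j, s, hj, hv, hp⟩ | ⟨j, s, hj, hv, hp⟩
    · obtain ⟨E, hE, h1, h2⟩ := key j s hj hv hp
      rwa [Finpartition.eq_of_mem_parts _ hB hE ih h1]
    · obtain ⟨E, hE, h1, h2⟩ := key j s hj hv hp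
      rwa [Finpartition.eq_of_mem_parts _ hB hE ih h2]

theorem reachable_of_mem_block (hd : 0 < d) (hT : m.labels = T.parkingFunction)
    (i : Fin (k + 1)) {u v : V} {B : Finset ℕ} (hB : B ∈ (m.elem i).1.parts)
    (hu : T.order u ∈ B) (hv : T.order v ∈ B) : (T.stepGraph i).Reachable u v := by
  induction i using Fin.induction generalizing u v B with
  | zero =>
    -- All numbers are minima of their blocks at the bottom, so the blocks are singletons.
    have key : ∀ w, T.order w ∈ B → ∀ y ∈ B, T.order w ≤ y := by
      intro w hw
      have h := T.order_mem_Icc w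
      rw [← m.minima_zero] at h
      exact (Finset.mem_filter.1 h).2 B hB hw
    rw [T.order_injective (le_antisymm (key u hu _ hv) (key v hv _ hu))]
  | succ i ih =>
    have hmono : T.stepGraph i.castSucc ≤ T.stepGraph i.succ := by
      intro u v huv
      rw [ParkingTree.stepGraph_adj] at *
      simp only [Fin.val_castSucc, Fin.val_succ] at *
      refine ⟨huv.1, huv.2.imp ?_ ?_⟩ <;>
      · rintro ⟨j, s, hj, h⟩
        exact ⟨j, s, by omega, h⟩
    obtain ⟨F, F₁, hF⟩ := m.exists_isMerge hd i
    by_cases hBF : B = F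
    · subst hBF
      -- Each piece of the new block is connected by induction; it contains `ω(p_i)`, or its minimum
      -- is some `ω(i_j)`, which a new edge joins to `p_i`.
      have key : ∀ w, T.order w ∈ B → (T.stepGraph i.succ).Reachable w (T.commonParent i) := by
        intro w hw
        obtain ⟨C, hC, hwC⟩ := (m.elem i.castSucc).1.exists_mem (T.order_mem_Icc w)
        have hCB := Finpartition.subset_of_le_of_mem hF.le hC hB hwC hw
        by_cases hne : C = F₁
        · subst hne
          have ha := hF.label_mem
          rw [hT] at ha
          exact (ih hC hwC ha).mono hmono
        · obtain ⟨x, hx, hmin⟩ := C.exists_min_image id ⟨_, hwC⟩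
          have hx' : x ∈ m.joinedMinima i := hF.mem_minima_sdiff_iff.2 ⟨C, hC, hCB, hne, hx, hmin⟩
          rw [joinedMinima_eq_childSet hd T hT] at hx'
          obtain ⟨j, rfl⟩ := T.mem_childSet.1 hx'
          refine ((ih hC hwC hx).mono hmono).trans (SimpleGraph.Adj.reachable ?_)
          rw [ParkingTree.stepGraph_adj]
          refine ⟨fun h => ?_, Or.inr ⟨i, j, by simp, rfl, T.parent_vertex i j⟩⟩
          have := T.parkingFunction_lt hx'
          rw [ParkingTree.parkingFunction, ← h] at this
          omega
      exact (key u hu).trans (key v hv).symm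
    · exact (ih (hF.mem_parts_of_ne B hB hBF) hu hv).mono hmono

theorem coe_block_eq (hd : 0 < d) (hT : m.labels = T.parkingFunction)
    (i : Fin (k + 1)) {v : V} {B : Finset ℕ} (hB : B ∈ (m.elem i).1.parts) (hv : T.order v ∈ B) :
    (B : Set ℕ) = T.order '' ((T.stepGraph i).connectedComponentMk v).supp := by
  ext x
  simp only [Set.mem_image, SimpleGraph.ConnectedComponent.mem_supp_iff,
    SimpleGraph.ConnectedComponent.eq, Finset.mem_coe]
  constructor
  · intro hx
    obtain ⟨u, rfl⟩ := T.exists_order_eq (Finpartition.subset _ hB hx)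
    exact ⟨u, reachable_of_mem_block hd hT i hB hx hv, rfl⟩
  · rintro ⟨u, hu, rfl⟩
    exact exists_block_of_reachable hd hT i hu.symm hB hv

end MaximalChainNC

theorem mainTheorem9 {d k : ℕ} (hd : 0 < d) (m : MaximalChainNC d k)
    {V : Type*} (T : ParkingTree d k V) (hT : m.labels = T.parkingFunction) :
    (∀ (i : Fin (k + 1)) (B : Finset ℕ),
      B ∈ (m.elem i).1.parts ↔
        ∃ c : (T.stepGraph i).ConnectedComponent, (B : Set ℕ) = T.order '' c.supp) ∧
    (∀ i : Fin k,
      (blocksMeeting (m.elem i.castSucc).1 (T.stepElements i)).card = d + 1 ∧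
      (m.elem i.succ).1.parts =
        insert ((blocksMeeting (m.elem i.castSucc).1 (T.stepElements i)).sup id)
          ((m.elem i.castSucc).1.parts \
            blocksMeeting (m.elem i.castSucc).1 (T.stepElements i))) := by
  refine ⟨fun i B => ⟨fun hB => ?_, ?_⟩, fun i => ?_⟩
  · obtain ⟨x, hx⟩ := Finpartition.nonempty_of_mem_parts _ hB
    obtain ⟨v, rfl⟩ := T.exists_order_eq (Finpartition.subset _ hB hx)
    exact ⟨_, MaximalChainNC.coe_block_eq hd hT i hB hx⟩
  · rintro ⟨c, hc⟩
    induction c using SimpleGraph.ConnectedComponent.ind with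
    | _ v =>
      obtain ⟨C, hC, hvC⟩ := (m.elem i).1.exists_mem (T.order_mem_Icc v)
      rw [← MaximalChainNC.coe_block_eq hd hT i hC hvC, Finset.coe_inj] at hc
      exact hc ▸ hC
  · obtain ⟨B, B₁, h⟩ := m.exists_isMerge hd i
    have hS : T.stepElements i = insert (m.labels i)
        (minima (m.elem i.castSucc).1 \ minima (m.elem i.succ).1) := by
      rw [hT]
      exact congrArg _ (MaximalChainNC.joinedMinima_eq_childSet hd T hT i).symm
    rw [hS, h.blocksMeeting_eq]
    exact ⟨h.card_eq, h.parts_eq⟩
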